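/- Let $d\ge 2$ be an integer, $c\ge 0$ a real number and $l\ge 0$ an integer, and put $$\nu_l=\sqrt{\left(l+\tfrac d2-1\right)^2+c^2}.$$ Let $J_\nu$ be the Bessel function of the first kind of order $\nu$ and $j_{\nu,k}$ ($k=1,2,\dots$) its $k$-th positive zero. Let $Y$ be a nonzero (real- or complex-valued) spherical harmonic of degree $l$ on $S^{d-1}$, i.e. the restriction to $S^{d-1}$ of a homogeneous harmonic polynomial of degree $l$ on $\mathbb R^d$ (for instance an element $Y_{lm}$ of an orthonormal basis of the space of spherical harmonics of degree $l$). For $k\ge 1$ let $$u_k(x)=|x|^{1-\frac d2}\,J_{\nu_l}\!\left(j_{\nu_l,k}|x|\right)\,Y\!\left(\frac{x}{|x|}\right),\qquad x\neq 0,$$ be the corresponding Dirichlet eigenfunction, with eigenvalue $j_{\nu_l,k}^2$, of the operator $-\Delta+c^2/|x|^2$ in the unit ball $\Omega=\{x\in\mathbb R^d:|x|<1\}$. Then for every $p$ with $$\frac{2d}{d-1}<p\le\infty$$ one has $0<\|u_k\|_{L^p(\Omega)}<\infty$ for all $k\ge 1$, and for every $\epsilon>0$, with $l$ and $Y$ fixed,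 $$\lim_{k\to\infty}\frac{\|u_k\|_{L^p(B(\epsilon))}}{\|u_k\|_{L^p(\Omega)}}=0,\qquad B(\epsilon)=\{x\in\mathbb R^d:\epsilon\le|x|\le 1\}.$$ -/

import Mathlib

open MeasureTheory Filter Topology

noncomputable section

/-- The Bessel function of the first kind `J_ν(t)` for real `t ≥ 0` and real order `ν ≥ 0`, by its
everywhere convergent series `∑ₙ (-1)ⁿ / (n! Γ(n + ν + 1)) (t / 2) ^ (2 n + ν)`. -/
def besselJ (ν t : ℝ) : ℝ :=
  ∑' n : ℕ, (-1 : ℝ) ^ n / ((n.factorial : ℝ) * Real.Gamma ((n : ℝ) + ν + 1)) *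
    (t / 2) ^ (2 * (n : ℝ) + ν)

/-- `besselZero ν k` is the `k`-th positive zero `j_{ν,k}` of `J_ν`, for `k = 1, 2, …`: the zeros
are listed in increasing order, each one being the least zero greater than the one before, and the
list is started at the auxiliary value `besselZero ν 0 = 0`. -/
def besselZero (ν : ℝ) : ℕ → ℝ
  | 0 => 0
  | k + 1 => sInf {t : ℝ | besselZero ν k < t ∧ besselJ ν t = 0}

/-- The space `H_l` of spherical harmonics of degree `l` on the unit sphere of `ℝ^d`, with values
in `𝕜 = ℝ` or `ℂ`: restrictions to the sphere of harmonic homogeneous polynomials of degree `l`. -/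
def sphericalHarmonics (𝕜 : Type*) [RCLike 𝕜] (d l : ℕ) :
    Submodule 𝕜 (Metric.sphere (0 : EuclideanSpace ℝ (Fin d)) 1 → 𝕜) where
  carrier := {Y | ∃ P : MvPolynomial (Fin d) 𝕜, P.IsHomogeneous l ∧
    ∑ i, MvPolynomial.pderiv i (MvPolynomial.pderiv i P) = 0 ∧
    ∀ ξ, Y ξ = MvPolynomial.eval (fun i => ((ξ : EuclideanSpace ℝ (Fin d)) i : 𝕜)) P}
  add_mem' := by
    rintro Y Z ⟨P, hP, hP', hY⟩ ⟨Q, hQ, hQ', hZ⟩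
    exact ⟨P + Q, hP.add hQ, by simp [Finset.sum_add_distrib, hP', hQ'],
      fun ξ => by simp [hY ξ, hZ ξ]⟩
  zero_mem' := ⟨0, MvPolynomial.isHomogeneous_zero _ _ _, by simp, fun ξ => by simp⟩
  smul_mem' := by
    rintro a Y ⟨P, hP, hP', hY⟩
    refine ⟨a • P, ?_, ?_, fun ξ => by simp [hY ξ]⟩
    · rw [MvPolynomial.smul_eq_C_mul]
      simpa using (MvPolynomial.isHomogeneous_C (Fin d) a).mul hP
    · have h : ∀ i, MvPolynomial.pderiv i (MvPolynomial.pderiv i (a • P)) =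
          a • MvPolynomial.pderiv i (MvPolynomial.pderiv i P) := fun i => by
        rw [Derivation.map_smul, Derivation.map_smul]
      rw [Finset.sum_congr rfl fun i _ => h i, ← Finset.smul_sum, hP', smul_zero]

/-- The order `ν_l = √((l + d / 2 - 1)² + c²)`. -/
def besselOrder (c : ℝ) (d l : ℕ) : ℝ :=
  Real.sqrt (((l : ℝ) + (d : ℝ) / 2 - 1) ^ 2 + c ^ 2)

/-- The eigenfunction of `-Δ + c² / |x|²` on the unit ball of `ℝ^d` with principal quantum number
`k ≥ 1`, azimuthal quantum number `l` and angular part `Y ∈ H_l`: in polar coordinates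
`x = r ξ` it is `r ^ (1 - d / 2) J_{ν_l}(j_{ν_l,k} r) Y(ξ)`. The value at the origin, a null set,
plays no role for the `L^p` norms and is set to `0`. -/
def ballEigenfunction {𝕜 : Type*} [RCLike 𝕜] (c : ℝ) (d l k : ℕ)
    (Y : Metric.sphere (0 : EuclideanSpace ℝ (Fin d)) 1 → 𝕜)
    (x : EuclideanSpace ℝ (Fin d)) : 𝕜 :=
  if hx : x = 0 then 0
  else
    ((‖x‖ ^ (1 - (d : ℝ) / 2) *
        besselJ (besselOrder c d l) (besselZero (besselOrder c d l) k * ‖x‖) : ℝ) : 𝕜) *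
      Y ⟨‖x‖⁻¹ • x, by simp [norm_smul, hx]⟩

end

/-! All the waves are dilates of one profile: with `j = j_{ν,k}` and `U(y) = |y|^(1 - d/2) J_ν(|y|)
Y(y/|y|)`, one has `u_k(x) = j^(d/2 - 1) U(j x)`. A fixed small ball on which `|U|` is bounded below
shrinks under this scaling to a ball of radius of order `1/j`, and this alone gives `‖u_k‖_p ≥ B
j^(d/2 - 1 - d/p)` on the unit ball. On the shell `ε ≤ |x| ≤ 1` the decay `J_ν(t) = O(t^(-1/2))`
gives `‖u_k‖_p ≤ A j^(-1/2)`. The quotient is therefore `O(j^(d/p - (d-1)/2))`, and the exponent is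
negative exactly when `p > 2d/(d-1)`. No asymptotics of the zeros are needed beyond `j_{ν,k} → ∞`.

The facts about `J_ν` come from the equation `w'' = (K/t² - 1) w` satisfied by `w = √t J_ν`. The
energy `w² + w'²`, corrected by a factor `exp(±|K|/t)`, is monotone (`antitoneOn_energy`,
`monotoneOn_energy`); this yields both the decay and the isolation of zeros. Sturm comparison
(`exists_zero_gt`) yields arbitrarily large zeros. Finiteness of the norms rests on `ν ≥ d/2 - 1`,
which makes each wave bounded near the origin. -/

/-! ### Everywhere convergent power series -/

/-- The coefficients of the derivative of the power series with coefficients `a`. -/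
def derivCoeff (a : ℕ → ℝ) (n : ℕ) : ℝ := ((n : ℝ) + 1) * a (n + 1)

/-- The factor `n + 1` cancels against `(n + 1)!`, so the bound survives with the same `C` and can
be iterated for higher derivatives. -/
theorem abs_derivCoeff_le {a : ℕ → ℝ} {C : ℝ} (h : ∀ n, |a n| ≤ C / n.factorial) (n : ℕ) :
    |derivCoeff a n| ≤ C / n.factorial := by
  have h1 := h (n + 1)
  have hn : (0 : ℝ) < (n : ℝ) + 1 := by positivity
  have hf : (0 : ℝ) < n.factorial := by positivity
  rw [derivCoeff, abs_mul, abs_of_pos hn]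
  rw [Nat.factorial_succ] at h1
  push_cast at h1
  calc ((n : ℝ) + 1) * |a (n + 1)| ≤ ((n : ℝ) + 1) * (C / (((n : ℝ) + 1) * n.factorial)) := by
        gcongr
    _ = C / n.factorial := by field_simp

theorem summable_mul_pow {a : ℕ → ℝ} {C : ℝ} (h : ∀ n, |a n| ≤ C / n.factorial) (x : ℝ) :
    Summable fun n => a n * x ^ n := by
  refine Summable.of_norm_bounded (g := fun n => C * (|x| ^ n / n.factorial))
    ((Real.summable_pow_div_factorial |x|).mul_left C) fun n => ?_
  rw [Real.norm_eq_abs, abs_mul, abs_pow]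
  calc |a n| * |x| ^ n ≤ C / n.factorial * |x| ^ n := by gcongr; exact h n
    _ = C * (|x| ^ n / n.factorial) := by ring

theorem hasDerivAt_tsum_mul_pow {a : ℕ → ℝ} {C : ℝ} (h : ∀ n, |a n| ≤ C / n.factorial) (x : ℝ) :
    HasDerivAt (fun y => ∑' n, a n * y ^ n) (∑' n, derivCoeff a n * x ^ n) x := by
  set R := |x| + 1
  have hR : 0 ≤ R := by positivity
  have hbound : ∀ y : ℝ, |y| ≤ R → ∀ n, ‖derivCoeff a n * y ^ n‖ ≤ C * (R ^ n / n.factorial) := by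
    intro y hy n
    rw [Real.norm_eq_abs, abs_mul, abs_pow]
    have h0 := abs_derivCoeff_le h n
    calc |derivCoeff a n| * |y| ^ n ≤ C / n.factorial * R ^ n := by
          have : 0 ≤ C / n.factorial := (abs_nonneg _).trans h0
          gcongr
      _ = C * (R ^ n / n.factorial) := by ring
  -- The constant term has derivative zero, so the majorant is the bound on the derivative's
  -- coefficients shifted by one, with `0` in front.
  set u : ℕ → ℝ := fun n => Nat.casesOn n 0 fun m => C * (R ^ m / m.factorial)
  have hu : Summable u := by
    rw [← summable_nat_add_iff 1]
    exact (Real.summable_pow_div_factorial R).mul_left C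
  have hshift : ∀ (y : ℝ) (n : ℕ),
      a (n + 1) * (((n + 1 : ℕ) : ℝ) * y ^ (n + 1 - 1)) = derivCoeff a n * y ^ n := by
    intro y n
    simp [derivCoeff]
    ring
  have hu' : ∀ (n : ℕ) (y : ℝ), y ∈ Metric.ball (0 : ℝ) R →
      ‖a n * ((n : ℝ) * y ^ (n - 1))‖ ≤ u n := by
    intro n y hy
    cases n with
    | zero => simp [u]
    | succ n =>
      rw [hshift]
      exact hbound y (by simpa using (mem_ball_zero_iff.1 hy).le) n
  have hx : x ∈ Metric.ball (0 : ℝ) R := by simp [R]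
  have key := hasDerivAt_tsum_of_isPreconnected (g := fun n y => a n * y ^ n)
    (g' := fun n y => a n * ((n : ℝ) * y ^ (n - 1))) hu Metric.isOpen_ball
    (convex_ball (0 : ℝ) R).isPreconnected
    (fun n y _ => (hasDerivAt_pow n y).const_mul (a n)) hu' hx (summable_mul_pow h x) hx
  refine key.congr_deriv ?_
  rw [(Summable.of_norm_bounded hu fun n => hu' n x hx).tsum_eq_zero_add]
  simp only [hshift]
  simp

/-! ### The differential equation `w'' = (K / t² - 1) w` -/

/-- `w` is a solution of `w'' = (K / t² - 1) w` on `(0, ∞)` with derivative `w'`. -/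
structure IsNormalSolution (K : ℝ) (w w' : ℝ → ℝ) : Prop where
  hasDerivAt : ∀ t, 0 < t → HasDerivAt w (w' t) t
  hasDerivAt' : ∀ t, 0 < t → HasDerivAt w' ((K / t ^ 2 - 1) * w t) t

namespace IsNormalSolution

variable {K : ℝ} {w w' : ℝ → ℝ}

theorem hasDerivAt_energy (h : IsNormalSolution K w w') (s : ℝ) {t : ℝ} (ht : 0 < t) :
    HasDerivAt (fun t => (w t ^ 2 + w' t ^ 2) * Real.exp (s / t))
      (Real.exp (s / t) / t ^ 2 * (2 * K * w t * w' t - s * (w t ^ 2 + w' t ^ 2))) t := by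
  have h1 := ((h.hasDerivAt t ht).pow 2).add ((h.hasDerivAt' t ht).pow 2)
  have h2 := ((hasDerivAt_inv ht.ne').const_mul s).exp
  have h3 := h1.mul h2
  simp only [← div_eq_mul_inv] at h3
  refine h3.congr_deriv ?_
  simp
  field_simp
  ring

/-- The derivative of `w² + w'²` is `2 K w w' / t²`, at most `|K| / t²` times the energy in absolute
value because `2 |w w'| ≤ w² + w'²`. The factor `exp(|K|/t)` absorbs it, and stays bounded as `t →
∞`. -/
theorem antitoneOn_energy (h : IsNormalSolution K w w') :
    AntitoneOn (fun t => (w t ^ 2 + w' t ^ 2) * Real.exp (|K| / t)) (Set.Ioi 0) := by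
  refine antitoneOn_of_deriv_nonpos (convex_Ioi 0)
    (fun t ht => (h.hasDerivAt_energy |K| ht).continuousAt.continuousWithinAt) ?_ ?_
  · rw [interior_Ioi]
    exact fun t ht => (h.hasDerivAt_energy |K| ht).differentiableAt.differentiableWithinAt
  · rw [interior_Ioi]
    intro t ht
    rw [(h.hasDerivAt_energy |K| ht).deriv]
    refine mul_nonpos_of_nonneg_of_nonpos (by positivity) ?_
    rcases abs_cases K with ⟨hK, hK'⟩ | ⟨hK, hK'⟩ <;> rw [hK]
    · nlinarith [mul_nonneg hK' (sq_nonneg (w t - w' t))]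
    · nlinarith [mul_nonneg (neg_nonneg.2 hK'.le) (sq_nonneg (w t + w' t))]

theorem monotoneOn_energy (h : IsNormalSolution K w w') :
    MonotoneOn (fun t => (w t ^ 2 + w' t ^ 2) * Real.exp (-|K| / t)) (Set.Ioi 0) := by
  refine monotoneOn_of_deriv_nonneg (convex_Ioi 0)
    (fun t ht => (h.hasDerivAt_energy (-|K|) ht).continuousAt.continuousWithinAt) ?_ ?_
  · rw [interior_Ioi]
    exact fun t ht => (h.hasDerivAt_energy (-|K|) ht).differentiableAt.differentiableWithinAt
  · rw [interior_Ioi]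
    intro t ht
    rw [(h.hasDerivAt_energy (-|K|) ht).deriv]
    refine mul_nonneg (by positivity) ?_
    rcases abs_cases K with ⟨hK, hK'⟩ | ⟨hK, hK'⟩ <;> rw [hK]
    · nlinarith [mul_nonneg hK' (sq_nonneg (w t + w' t))]
    · nlinarith [mul_nonneg (neg_nonneg.2 hK'.le) (sq_nonneg (w t - w' t))]

theorem exists_abs_le (h : IsNormalSolution K w w') : ∃ C, 0 ≤ C ∧ ∀ t, 1 ≤ t → |w t| ≤ C := by
  refine ⟨√((w 1 ^ 2 + w' 1 ^ 2) * Real.exp (|K| / 1)), by positivity, fun t ht => ?_⟩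
  have ht0 : 0 < t := by linarith
  apply Real.abs_le_sqrt
  refine le_trans ?_ (h.antitoneOn_energy (Set.mem_Ioi.2 one_pos) (Set.mem_Ioi.2 ht0) ht)
  have h1 : 1 ≤ Real.exp (|K| / t) := Real.one_le_exp (by positivity)
  nlinarith [sq_nonneg (w t), sq_nonneg (w' t)]

/-- Unique continuation towards the origin: the increasing energy vanishes at `L`, hence at every
earlier point. -/
theorem eq_zero_of_le (h : IsNormalSolution K w w') {L t : ℝ} (ht : 0 < t) (htL : t ≤ L)
    (hw : w L = 0) (hw' : w' L = 0) : w t = 0 := by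
  have h1 := h.monotoneOn_energy (Set.mem_Ioi.2 ht) (Set.mem_Ioi.2 (ht.trans_le htL)) htL
  simp only [hw, hw'] at h1
  have h2 : 0 < Real.exp (-|K| / t) := Real.exp_pos _
  have h3 : w t ^ 2 + w' t ^ 2 ≤ 0 := by
    by_contra! h3
    have := mul_pos h3 h2
    norm_num at h1
    linarith
  have h4 : w t ^ 2 = 0 := by nlinarith [sq_nonneg (w t), sq_nonneg (w' t)]
  exact pow_eq_zero_iff two_ne_zero |>.1 h4

/-- A double zero at `L` would kill `w` on all of `(0, L]`, against `h0`. So every zero is simple,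
hence isolated. -/
theorem eventually_ne_zero (h : IsNormalSolution K w w') (h0 : ∃ᶠ t in 𝓝[>] 0, w t ≠ 0)
    {L : ℝ} (hL : 0 < L) : ∀ᶠ t in 𝓝[≠] L, w t ≠ 0 := by
  by_cases hw : w L = 0
  · refine (h.hasDerivAt L hL).eventually_ne fun hw' => ?_
    obtain ⟨t, ht, ht'⟩ := (h0.and_eventually (Ioc_mem_nhdsGT hL)).exists
    exact ht (h.eq_zero_of_le ht'.1 ht'.2 hw hw')
  · exact ((h.hasDerivAt L hL).continuousAt.eventually_ne hw).filter_mono nhdsWithin_le_nhds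

theorem neg (h : IsNormalSolution K w w') : IsNormalSolution K (-w) (-w') where
  hasDerivAt t ht := (h.hasDerivAt t ht).neg
  hasDerivAt' t ht := ((h.hasDerivAt' t ht).neg).congr_deriv (by simp)

/-- Sturm comparison with `sin ((t - a) / 2)`. -/
theorem not_pos_on_Icc (h : IsNormalSolution K w w') {a : ℝ} (ha : 0 < a)
    (hK : ∀ t, a ≤ t → K / t ^ 2 ≤ 3 / 4) :
    ¬ ∀ t ∈ Set.Icc a (a + 2 * Real.pi), 0 < w t := by
  intro hpos
  have hpi := Real.pi_pos
  -- The Wronskian of `w` and `v = sin((t - a)/2)`, where `v'' = -v/4`. It decreases while `w > 0`,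
  -- yet goes from `-w(a)/2` to `w(a + 2π)/2`.
  have hd : ∀ t ∈ Set.Icc a (a + 2 * Real.pi), HasDerivAt
      (fun t => w' t * Real.sin ((t - a) / 2) - w t * (Real.cos ((t - a) / 2) / 2))
      ((K / t ^ 2 - 3 / 4) * w t * Real.sin ((t - a) / 2)) t := by
    intro t ht
    have ht0 : 0 < t := ha.trans_le ht.1
    have hl : HasDerivAt (fun t : ℝ => (t - a) / 2) (1 / 2) t :=
      ((hasDerivAt_id t).sub_const a).div_const 2
    refine (((h.hasDerivAt' t ht0).mul hl.sin).sub
      ((h.hasDerivAt t ht0).mul (hl.cos.div_const 2))).congr_deriv ?_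
    ring
  have hanti : AntitoneOn
      (fun t => w' t * Real.sin ((t - a) / 2) - w t * (Real.cos ((t - a) / 2) / 2))
      (Set.Icc a (a + 2 * Real.pi)) := by
    refine antitoneOn_of_deriv_nonpos (convex_Icc _ _)
      (fun t ht => (hd t ht).continuousAt.continuousWithinAt)
      (fun t ht => (hd t (interior_subset ht)).differentiableAt.differentiableWithinAt) ?_
    intro t ht
    have ht := interior_subset ht
    rw [(hd t ht).deriv]
    have h1 : 0 ≤ Real.sin ((t - a) / 2) :=
      Real.sin_nonneg_of_nonneg_of_le_pi (by linarith [ht.1]) (by linarith [ht.2])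
    have h2 := hpos t ht
    have h3 := hK t ht.1
    exact mul_nonpos_of_nonpos_of_nonneg
      (mul_nonpos_of_nonpos_of_nonneg (by linarith) h2.le) h1
  have hl : a ∈ Set.Icc a (a + 2 * Real.pi) := ⟨le_rfl, by linarith⟩
  have hr : a + 2 * Real.pi ∈ Set.Icc a (a + 2 * Real.pi) := ⟨by linarith, le_rfl⟩
  have h1 := hanti hl hr (by linarith)
  have h2 : (a + 2 * Real.pi - a) / 2 = Real.pi := by ring
  simp only [h2, sub_self, zero_div, Real.sin_pi, Real.cos_pi, Real.sin_zero, Real.cos_zero] at h1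
  linarith [hpos _ hl, hpos _ hr]

theorem exists_zero_gt (h : IsNormalSolution K w w') (T : ℝ) : ∃ t, T < t ∧ w t = 0 := by
  by_contra! hne
  -- The first entry puts `a` beyond `T` and above `1`; the second gives `K/t² ≤ |K|/t ≤ 1/2` for `t
  -- ≥ a`.
  set a := max (|T| + 1) (|K| * 2 + 1)
  have ha1 : 1 ≤ a := le_max_of_le_left (by linarith [abs_nonneg T])
  have haT : T < a := lt_max_of_lt_left (by linarith [le_abs_self T])
  have haK : |K| * 2 + 1 ≤ a := le_max_right _ _
  have ha : 0 < a := by linarith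
  have hK : ∀ t, a ≤ t → K / t ^ 2 ≤ 3 / 4 := by
    intro t hat
    have : 0 < t := by linarith
    rw [div_le_iff₀ (by positivity)]
    nlinarith [le_abs_self K]
  have hne' : ∀ t ∈ Set.Icc a (a + 2 * Real.pi), w t ≠ 0 := fun t ht => hne t (haT.trans_le ht.1)
  have hcont : ContinuousOn w (Set.Icc a (a + 2 * Real.pi)) := fun t ht =>
    (h.hasDerivAt t (ha.trans_le ht.1)).continuousAt.continuousWithinAt
  have hmem : a ∈ Set.Icc a (a + 2 * Real.pi) := ⟨le_rfl, by linarith [Real.pi_pos]⟩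
  rcases lt_or_gt_of_ne (hne' a hmem) with hs | hs
  · refine h.neg.not_pos_on_Icc ha hK fun t ht => ?_
    by_contra! hle
    obtain ⟨z, hz, hz0⟩ := isPreconnected_Icc.intermediate_value hmem ht hcont
      ⟨hs.le, by simpa using hle⟩
    exact hne' z hz hz0
  · refine h.not_pos_on_Icc ha hK fun t ht => ?_
    by_contra! hle
    obtain ⟨z, hz, hz0⟩ := isPreconnected_Icc.intermediate_value ht hmem hcont ⟨hle, hs.le⟩
    exact hne' z hz hz0

end IsNormalSolution

/-! ### The Bessel function -/

/-- The coefficients of the entire function `g` with `J_ν(t) = (t / 2) ^ ν g(t² / 4)`. -/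
noncomputable def besselCoeff (ν : ℝ) (n : ℕ) : ℝ :=
  (-1 : ℝ) ^ n / ((n.factorial : ℝ) * Real.Gamma ((n : ℝ) + ν + 1))

theorem besselGamma_pos {ν : ℝ} (hν : 0 ≤ ν) (n : ℕ) : 0 < Real.Gamma ((n : ℝ) + ν + 1) :=
  Real.Gamma_pos_of_pos (by positivity)

theorem besselGamma_succ {ν : ℝ} (hν : 0 ≤ ν) (n : ℕ) :
    Real.Gamma (((n + 1 : ℕ) : ℝ) + ν + 1) = ((n : ℝ) + ν + 1) * Real.Gamma ((n : ℝ) + ν + 1) := by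
  rw [← Real.Gamma_add_one (by positivity)]
  congr 1
  push_cast
  ring

/-- `Γ` is not monotone on `(1, 2)`, but an integer step multiplies it by `n + ν + 1 ≥ 1`. -/
theorem Gamma_le_besselGamma {ν : ℝ} (hν : 0 ≤ ν) (n : ℕ) :
    Real.Gamma (ν + 1) ≤ Real.Gamma ((n : ℝ) + ν + 1) := by
  induction n with
  | zero => simp
  | succ n ih =>
    rw [besselGamma_succ hν]
    have h1 := besselGamma_pos hν n
    have h2 : (0 : ℝ) ≤ (n : ℝ) + ν := by positivity
    nlinarith

theorem abs_besselCoeff_le {ν : ℝ} (hν : 0 ≤ ν) (n : ℕ) :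
    |besselCoeff ν n| ≤ (Real.Gamma (ν + 1))⁻¹ / n.factorial := by
  have h0 : 0 < Real.Gamma (ν + 1) := Real.Gamma_pos_of_pos (by positivity)
  have h1 := Gamma_le_besselGamma hν n
  have h2 := besselGamma_pos hν n
  rw [besselCoeff, abs_div, abs_pow, abs_neg, abs_one, one_pow, abs_of_pos (by positivity),
    inv_eq_one_div, div_div, mul_comm]
  gcongr

/-- The coefficient of `x^n` in the equation `x g'' + (ν + 1) g' + g = 0`. -/
theorem besselCoeff_recurrence {ν : ℝ} (hν : 0 ≤ ν) (n : ℕ) :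
    (n : ℝ) * derivCoeff (besselCoeff ν) n + (ν + 1) * derivCoeff (besselCoeff ν) n
      + besselCoeff ν n = 0 := by
  have h1 := besselGamma_pos hν n
  have h2 : (0 : ℝ) < (n : ℝ) + ν + 1 := by positivity
  simp only [derivCoeff, besselCoeff]
  rw [besselGamma_succ hν, Nat.factorial_succ]
  push_cast
  field_simp
  ring

/-- The entire function `g` with `J_ν(t) = (t / 2) ^ ν g(t² / 4)`. -/
noncomputable def besselEntire (ν x : ℝ) : ℝ := ∑' n, besselCoeff ν n * x ^ n

/-- The derivative of `besselEntire`. -/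
noncomputable def besselEntireDeriv (ν x : ℝ) : ℝ := ∑' n, derivCoeff (besselCoeff ν) n * x ^ n

/-- The second derivative of `besselEntire`. -/
noncomputable def besselEntireDerivTwo (ν x : ℝ) : ℝ := ∑' n, derivCoeff (derivCoeff (besselCoeff ν)) n * x ^ n

theorem hasDerivAt_besselEntire {ν : ℝ} (hν : 0 ≤ ν) (x : ℝ) :
    HasDerivAt (besselEntire ν) (besselEntireDeriv ν x) x :=
  hasDerivAt_tsum_mul_pow (abs_besselCoeff_le hν) x

theorem hasDerivAt_besselEntireDeriv {ν : ℝ} (hν : 0 ≤ ν) (x : ℝ) :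
    HasDerivAt (besselEntireDeriv ν) (besselEntireDerivTwo ν x) x :=
  hasDerivAt_tsum_mul_pow (abs_derivCoeff_le (abs_besselCoeff_le hν)) x

theorem continuous_besselEntire {ν : ℝ} (hν : 0 ≤ ν) : Continuous (besselEntire ν) :=
  continuous_iff_continuousAt.2 fun x => (hasDerivAt_besselEntire hν x).continuousAt

theorem besselEntire_ode {ν : ℝ} (hν : 0 ≤ ν) (x : ℝ) :
    x * besselEntireDerivTwo ν x + (ν + 1) * besselEntireDeriv ν x + besselEntire ν x = 0 := by
  have ha := abs_besselCoeff_le hν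
  have hb := abs_derivCoeff_le ha
  have hc := abs_derivCoeff_le hb
  have h0 := (summable_mul_pow ha x).hasSum
  have h1 := (summable_mul_pow hb x).hasSum.mul_left (ν + 1)
  have h2 : HasSum (fun n : ℕ => (n : ℝ) * derivCoeff (besselCoeff ν) n * x ^ n)
      (x * besselEntireDerivTwo ν x) := by
    have h3 := (summable_mul_pow hc x).hasSum.mul_left x
    -- Multiplication by `x` shifts the index by one; the missing term `n = 0` vanishes because of
    -- the factor `n`.
    have h4 := (hasSum_nat_add_iff
      (f := fun n : ℕ => (n : ℝ) * derivCoeff (besselCoeff ν) n * x ^ n) 1).1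
      (h3.congr_fun (g := fun n : ℕ => ((n + 1 : ℕ) : ℝ) * derivCoeff (besselCoeff ν) (n + 1) *
        x ^ (n + 1)) ?_)
    · simpa [besselEntireDerivTwo] using h4
    · intro n
      simp [derivCoeff]
      ring
  refine ((h2.add h1).add h0).unique ?_
  convert hasSum_zero using 2 with n
  linear_combination x ^ n * besselCoeff_recurrence hν n

theorem besselEntire_zero_pos {ν : ℝ} (hν : 0 ≤ ν) : 0 < besselEntire ν 0 := by
  rw [besselEntire, tsum_eq_single 0 fun n hn => by simp [hn]]
  have := besselGamma_pos hν 0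
  simp only [besselCoeff]
  simp at this ⊢
  exact this

theorem besselJ_eq {ν t : ℝ} (ht : 0 < t) :
    besselJ ν t = (t / 2) ^ ν * besselEntire ν (t ^ 2 / 4) := by
  rw [besselJ, besselEntire, ← tsum_mul_left]
  congr 1
  ext n
  rw [besselCoeff, Real.rpow_add (by positivity), Real.rpow_mul (by positivity), Real.rpow_natCast,
    Real.rpow_two]
  rw [show (t / 2) ^ 2 = t ^ 2 / 4 by ring]
  ring

theorem besselEntire_ne_zero_iff {ν t : ℝ} (ht : 0 < t) :
    besselEntire ν (t ^ 2 / 4) ≠ 0 ↔ besselJ ν t ≠ 0 := by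
  have : (t / 2) ^ ν ≠ 0 := (Real.rpow_pos_of_pos (by positivity) _).ne'
  simp [besselJ_eq ht, this]

/-- Up to a constant factor, `√t J_ν(t)`. -/
noncomputable def besselNormal (ν t : ℝ) : ℝ := t ^ (ν + 1 / 2) * besselEntire ν (t ^ 2 / 4)

/-- The derivative of `besselNormal`. -/
noncomputable def besselNormalDeriv (ν t : ℝ) : ℝ :=
  (ν + 1 / 2) * t ^ (ν + 1 / 2 - 1) * besselEntire ν (t ^ 2 / 4) +
    t ^ (ν + 1 / 2) * (besselEntireDeriv ν (t ^ 2 / 4) * (t / 2))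

/-- Liouville normal form: the factor `√t` removes the first-order term of Bessel's equation. -/
theorem isNormalSolution_bessel {ν : ℝ} (hν : 0 ≤ ν) :
    IsNormalSolution (ν ^ 2 - 1 / 4) (besselNormal ν) (besselNormalDeriv ν) := by
  have hsq : ∀ t : ℝ, HasDerivAt (fun t : ℝ => t ^ 2 / 4) (t / 2) t := fun t =>
    ((hasDerivAt_pow 2 t).div_const 4).congr_deriv (by norm_num; ring)
  have hg : ∀ t : ℝ, HasDerivAt (fun t => besselEntire ν (t ^ 2 / 4))
      (besselEntireDeriv ν (t ^ 2 / 4) * (t / 2)) t := fun t =>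
    (hasDerivAt_besselEntire hν _).comp t (hsq t)
  have hg' : ∀ t : ℝ, HasDerivAt (fun t => besselEntireDeriv ν (t ^ 2 / 4))
      (besselEntireDerivTwo ν (t ^ 2 / 4) * (t / 2)) t := fun t =>
    (hasDerivAt_besselEntireDeriv hν _).comp t (hsq t)
  have hp : ∀ (α t : ℝ), 0 < t → HasDerivAt (fun t : ℝ => t ^ α) (α * t ^ (α - 1)) t :=
    fun α t ht => Real.hasDerivAt_rpow_const (Or.inl ht.ne')
  constructor
  · intro t ht
    exact (hp _ t ht).mul (hg t)
  · intro t ht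
    refine ((((hp _ t ht).const_mul (ν + 1 / 2)).mul (hg t)).add
      ((hp _ t ht).mul ((hg' t).mul ((hasDerivAt_id t).div_const 2)))).congr_deriv ?_
    have h := besselEntire_ode hν (t ^ 2 / 4)
    simp only [besselNormal, id, Pi.mul_apply]
    rw [Real.rpow_sub_one ht.ne', Real.rpow_sub_one ht.ne']
    field_simp
    linear_combination 16 * t ^ 2 * h

theorem besselJ_eq_besselNormal {ν t : ℝ} (ht : 0 < t) :
    besselJ ν t = (2 ^ ν)⁻¹ * t ^ (-(1 / 2) : ℝ) * besselNormal ν t := by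
  have h : t ^ ν = t ^ (-(1 / 2) : ℝ) * t ^ (ν + 1 / 2) := by
    rw [← Real.rpow_add ht]
    ring_nf
  rw [besselJ_eq ht, besselNormal, Real.div_rpow ht.le zero_le_two, h]
  ring

theorem exists_abs_besselJ_le {ν : ℝ} (hν : 0 ≤ ν) :
    ∃ C, 0 ≤ C ∧ ∀ t, 1 ≤ t → |besselJ ν t| ≤ C * t ^ (-(1 / 2) : ℝ) := by
  obtain ⟨C, hC, h⟩ := (isNormalSolution_bessel hν).exists_abs_le
  refine ⟨(2 ^ ν)⁻¹ * C, by positivity, fun t ht => ?_⟩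
  have ht0 : 0 < t := by linarith
  rw [besselJ_eq_besselNormal ht0, abs_mul, abs_of_nonneg (by positivity)]
  calc (2 ^ ν)⁻¹ * t ^ (-(1 / 2) : ℝ) * |besselNormal ν t|
      ≤ (2 ^ ν)⁻¹ * t ^ (-(1 / 2) : ℝ) * C := by gcongr; exact h t ht
    _ = _ := by ring

theorem besselNormal_ne_zero_iff {ν t : ℝ} (ht : 0 < t) :
    besselNormal ν t ≠ 0 ↔ besselJ ν t ≠ 0 := by
  have h1 : ((2 : ℝ) ^ ν) ≠ 0 := (Real.rpow_pos_of_pos two_pos _).ne'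
  have h2 : t ^ (-(1 / 2) : ℝ) ≠ 0 := (Real.rpow_pos_of_pos ht _).ne'
  rw [besselJ_eq_besselNormal ht]
  simp [h1, h2, -one_div]

/-- Near `0` the entire factor is close to its constant term `1/Γ(ν + 1) > 0`. -/
theorem eventually_besselJ_ne_zero_nhdsGT {ν : ℝ} (hν : 0 ≤ ν) :
    ∀ᶠ t in 𝓝[>] 0, besselJ ν t ≠ 0 := by
  have h : Tendsto (fun t : ℝ => besselEntire ν (t ^ 2 / 4)) (𝓝[>] 0) (𝓝 (besselEntire ν 0)) := by
    have hc : Continuous fun t : ℝ => besselEntire ν (t ^ 2 / 4) :=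
      (continuous_besselEntire hν).comp (by fun_prop)
    simpa using hc.continuousAt (x := 0) |>.tendsto.mono_left nhdsWithin_le_nhds
  filter_upwards [h.eventually_ne (besselEntire_zero_pos hν).ne', self_mem_nhdsWithin] with t ht h0
  exact (besselEntire_ne_zero_iff h0).1 ht

theorem eventually_besselJ_ne_zero {ν : ℝ} (hν : 0 ≤ ν) {L : ℝ} (hL : 0 < L) :
    ∀ᶠ t in 𝓝[≠] L, besselJ ν t ≠ 0 := by
  have h0 : ∃ᶠ t in 𝓝[>] 0, besselNormal ν t ≠ 0 := by
    refine Eventually.frequently ?_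
    filter_upwards [eventually_besselJ_ne_zero_nhdsGT hν, self_mem_nhdsWithin] with t ht h
    exact (besselNormal_ne_zero_iff h).2 ht
  filter_upwards [(isNormalSolution_bessel hν).eventually_ne_zero h0 hL,
    nhdsWithin_le_nhds (lt_mem_nhds hL)] with t ht h
  exact (besselNormal_ne_zero_iff h).1 ht

theorem exists_besselJ_eq_zero_gt {ν : ℝ} (hν : 0 ≤ ν) (T : ℝ) :
    ∃ t, T < t ∧ besselJ ν t = 0 := by
  obtain ⟨t, ht, h⟩ := (isNormalSolution_bessel hν).exists_zero_gt (max T 0)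
  refine ⟨t, (le_max_left _ _).trans_lt ht, ?_⟩
  by_contra hne
  exact (besselNormal_ne_zero_iff ((le_max_right _ _).trans_lt ht)).2 hne h

/-! ### The zeros -/

/-- An infimum that is not attained would be a limit of zeros from the right. This contradicts
isolation if the infimum is positive, and the behaviour of the series near `0` if it is `0`. -/
theorem isLeast_sInf_besselJ_zeros {ν : ℝ} (hν : 0 ≤ ν) {a : ℝ} (ha : 0 ≤ a) :
    IsLeast {t : ℝ | a < t ∧ besselJ ν t = 0} (sInf {t : ℝ | a < t ∧ besselJ ν t = 0}) := by
  set S := {t : ℝ | a < t ∧ besselJ ν t = 0}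
  have hS : S.Nonempty := exists_besselJ_eq_zero_gt hν a
  have hbdd : BddBelow S := ⟨a, fun t ht => ht.1.le⟩
  have hglb := isGLB_csInf hS hbdd
  refine ⟨?_, hglb.1⟩
  by_contra hmem
  have hfreq : ∃ᶠ t in 𝓝[>] (sInf S), t ∈ S := by
    rw [frequently_iff]
    intro U hU
    obtain ⟨b, hb, hbU⟩ := (mem_nhdsGT_iff_exists_Ioo_subset).1 hU
    obtain ⟨t, htS, htb⟩ := (csInf_lt_iff hbdd hS).1 hb
    exact ⟨t, hbU ⟨lt_of_le_of_ne (hglb.1 htS) fun h => hmem (h ▸ htS), htb⟩, htS⟩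
  have hge : a ≤ sInf S := le_csInf hS fun t ht => ht.1.le
  have hev : ∀ᶠ t in 𝓝[>] (sInf S), besselJ ν t ≠ 0 := by
    rcases (ha.trans hge).eq_or_lt with h0 | h0
    · rw [← h0]
      exact eventually_besselJ_ne_zero_nhdsGT hν
    · exact (eventually_besselJ_ne_zero hν h0).filter_mono
        (nhdsWithin_mono _ fun t ht => ne_of_gt ht)
  obtain ⟨t, ht, ht'⟩ := (hfreq.and_eventually hev).exists
  exact ht' ht.2

theorem besselZero_nonneg {ν : ℝ} (hν : 0 ≤ ν) (k : ℕ) : 0 ≤ besselZero ν k := by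
  induction k with
  | zero => exact le_rfl
  | succ k ih => exact ih.trans (isLeast_sInf_besselJ_zeros hν ih).1.1.le

theorem besselZero_strictMono {ν : ℝ} (hν : 0 ≤ ν) : StrictMono (besselZero ν) :=
  strictMono_nat_of_lt_succ fun k =>
    (isLeast_sInf_besselJ_zeros hν (besselZero_nonneg hν k)).1.1

theorem besselZero_pos {ν : ℝ} (hν : 0 ≤ ν) {k : ℕ} (hk : 1 ≤ k) : 0 < besselZero ν k :=
  (besselZero_nonneg hν 0).trans_lt (besselZero_strictMono hν hk)

theorem besselJ_besselZero_succ {ν : ℝ} (hν : 0 ≤ ν) (k : ℕ) :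
    besselJ ν (besselZero ν (k + 1)) = 0 :=
  (isLeast_sInf_besselJ_zeros hν (besselZero_nonneg hν k)).1.2

/-- Otherwise the increasing zeros would accumulate at some finite `L > 0`, where zeros are
isolated. -/
theorem tendsto_besselZero {ν : ℝ} (hν : 0 ≤ ν) : Tendsto (besselZero ν) atTop atTop := by
  have hmono := besselZero_strictMono hν
  rcases tendsto_atTop_of_monotone hmono.monotone with h | ⟨L, hL⟩
  · exact h
  · have hlt : ∀ k, besselZero ν k < L := fun k =>
      (hmono k.lt_succ_self).trans_le (hmono.monotone.ge_of_tendsto hL _)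
    have hL' : Tendsto (fun k => besselZero ν (k + 1)) atTop (𝓝[≠] L) :=
      tendsto_nhdsWithin_iff.2 ⟨(tendsto_add_atTop_iff_nat 1).2 hL,
        Eventually.of_forall fun k => (hlt _).ne⟩
    obtain ⟨k, hk⟩ := (hL'.eventually (eventually_besselJ_ne_zero hν
      ((besselZero_nonneg hν 0).trans_lt (hlt 0)))).exists
    exact absurd (besselJ_besselZero_succ hν k) hk

/-! ### The eigenfunctions -/

theorem continuousAt_besselJ {ν t : ℝ} (hν : 0 ≤ ν) (ht : 0 < t) : ContinuousAt (besselJ ν) t := by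
  have h : ContinuousAt (fun t : ℝ => (t / 2) ^ ν * besselEntire ν (t ^ 2 / 4)) t := by
    refine ContinuousAt.mul ?_ ?_
    · exact (continuousAt_id.div_const 2).rpow_const (Or.inr hν)
    · exact ((continuous_besselEntire hν).comp (by fun_prop)).continuousAt
  refine h.congr ?_
  filter_upwards [lt_mem_nhds ht] with s hs using (besselJ_eq hs).symm

theorem continuous_of_mem_sphericalHarmonics {𝕜 : Type*} [RCLike 𝕜] {d l : ℕ}
    {Y : Metric.sphere (0 : EuclideanSpace ℝ (Fin d)) 1 → 𝕜} (hY : Y ∈ sphericalHarmonics 𝕜 d l) :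
    Continuous Y := by
  obtain ⟨P, -, -, h⟩ := hY
  rw [funext h]
  refine (MvPolynomial.continuous_eval P).comp (continuous_pi fun i => ?_)
  exact RCLike.continuous_ofReal.comp (by fun_prop)

theorem besselOrder_nonneg (c : ℝ) (d l : ℕ) : 0 ≤ besselOrder c d l := Real.sqrt_nonneg _

theorem le_besselOrder (c : ℝ) (d l : ℕ) : (d : ℝ) / 2 - 1 ≤ besselOrder c d l := by
  refine le_trans ?_ (Real.le_sqrt_of_sq_le (le_add_of_nonneg_right (sq_nonneg c)))
  linarith [(Nat.cast_nonneg l : (0 : ℝ) ≤ l)]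

section Wave

variable {𝕜 : Type*} [RCLike 𝕜] {d : ℕ}

/-- The function `r ^ (1 - d / 2) J_ν(j r) Y(ξ)` in polar coordinates `x = r ξ`. -/
noncomputable def sphericalWave (ν : ℝ) (j : ℝ)
    (Y : Metric.sphere (0 : EuclideanSpace ℝ (Fin d)) 1 → 𝕜) (x : EuclideanSpace ℝ (Fin d)) : 𝕜 :=
  if hx : x = 0 then 0
  else
    ((‖x‖ ^ (1 - (d : ℝ) / 2) * besselJ ν (j * ‖x‖) : ℝ) : 𝕜) *
      Y ⟨‖x‖⁻¹ • x, by simp [norm_smul, hx]⟩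

theorem ballEigenfunction_eq (c : ℝ) (l k : ℕ)
    (Y : Metric.sphere (0 : EuclideanSpace ℝ (Fin d)) 1 → 𝕜) :
    ballEigenfunction c d l k Y =
      sphericalWave (besselOrder c d l) (besselZero (besselOrder c d l) k) Y := rfl

variable {Y : Metric.sphere (0 : EuclideanSpace ℝ (Fin d)) 1 → 𝕜}

theorem continuousOn_sphericalWave {ν j : ℝ} (hν : 0 ≤ ν) (hj : 0 < j) (hY : Continuous Y) :
    ContinuousOn (sphericalWave ν j Y) {0}ᶜ := by
  rw [continuousOn_iff_continuous_domRestrict]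
  have hn : ∀ x : ({0}ᶜ : Set (EuclideanSpace ℝ (Fin d))), 0 < ‖(x : EuclideanSpace ℝ (Fin d))‖ :=
    fun x => norm_pos_iff.2 x.2
  have heq : Set.domRestrict {0}ᶜ (sphericalWave ν j Y) =
      fun x : ({0}ᶜ : Set (EuclideanSpace ℝ (Fin d))) =>
      ((‖(x : EuclideanSpace ℝ (Fin d))‖ ^ (1 - (d : ℝ) / 2) * besselJ ν (j * ‖x.1‖) : ℝ) : 𝕜) *
        Y ⟨‖x.1‖⁻¹ • x.1, by simp [norm_smul, (hn x).ne']⟩ := by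
    ext x
    have hx : (x : EuclideanSpace ℝ (Fin d)) ≠ 0 := x.2
    simp only [Set.domRestrict_apply, sphericalWave, dif_neg hx]
  rw [heq]
  have hnorm : Continuous fun x : ({0}ᶜ : Set (EuclideanSpace ℝ (Fin d))) => ‖x.1‖ :=
    continuous_norm.comp continuous_subtype_val
  have hpow : Continuous fun x : ({0}ᶜ : Set (EuclideanSpace ℝ (Fin d))) =>
      ‖x.1‖ ^ (1 - (d : ℝ) / 2) := hnorm.rpow_const fun x => Or.inl (hn x).ne'
  have hJ : Continuous fun x : ({0}ᶜ : Set (EuclideanSpace ℝ (Fin d))) =>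
      besselJ ν (j * ‖x.1‖) := by
    refine continuous_iff_continuousAt.2 fun x => ?_
    have hf : ContinuousAt (fun x : ({0}ᶜ : Set (EuclideanSpace ℝ (Fin d))) => j * ‖x.1‖) x :=
      (hnorm.const_mul j).continuousAt
    exact (continuousAt_besselJ hν (mul_pos hj (hn x))).tendsto.comp hf
  have hdir : Continuous fun x : ({0}ᶜ : Set (EuclideanSpace ℝ (Fin d))) => ‖x.1‖⁻¹ • x.1 :=
    (hnorm.inv₀ fun x => (hn x).ne').smul continuous_subtype_val
  exact (RCLike.continuous_ofReal.comp (hpow.mul hJ)).mul (hY.comp (hdir.subtype_mk _))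

theorem aestronglyMeasurable_sphericalWave (hd : 2 ≤ d) {ν j : ℝ} (hν : 0 ≤ ν) (hj : 0 < j)
    (hY : Continuous Y) : AEStronglyMeasurable (sphericalWave ν j Y) volume := by
  have : Nonempty (Fin d) := ⟨⟨0, by omega⟩⟩
  have h := (continuousOn_sphericalWave hν hj hY).aestronglyMeasurable (μ := volume)
    (measurableSet_singleton (0 : EuclideanSpace ℝ (Fin d))).compl
  rwa [Measure.restrict_eq_self_of_ae_mem] at h
  exact compl_mem_ae_iff.2 (measure_singleton 0)

theorem norm_sphericalWave_eq (ν : ℝ) {j : ℝ} (hj : 0 < j) (x : EuclideanSpace ℝ (Fin d)) :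
    ‖sphericalWave ν j Y x‖ = j ^ ((d : ℝ) / 2 - 1) * ‖sphericalWave ν 1 Y (j • x)‖ := by
  by_cases hx : x = 0
  · simp [sphericalWave, hx]
  have hjx : j • x ≠ 0 := smul_ne_zero hj.ne' hx
  have hn : 0 < ‖x‖ := norm_pos_iff.2 hx
  have hpt : ‖j • x‖⁻¹ • (j • x) = ‖x‖⁻¹ • x := by
    rw [norm_smul, Real.norm_of_nonneg hj.le, smul_smul]
    congr 1
    field_simp
  have hpow : ‖x‖ ^ (1 - (d : ℝ) / 2) =
      j ^ ((d : ℝ) / 2 - 1) * (j * ‖x‖) ^ (1 - (d : ℝ) / 2) := by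
    rw [Real.mul_rpow hj.le hn.le, ← mul_assoc, ← Real.rpow_add hj]
    simp
  have hjn : ‖j • x‖ = j * ‖x‖ := by rw [norm_smul, Real.norm_of_nonneg hj.le]
  simp only [sphericalWave, dif_neg hx, dif_neg hjx, norm_mul, hpt, RCLike.norm_ofReal, abs_mul]
  simp only [hjn, one_mul, hpow, abs_mul, abs_of_nonneg (Real.rpow_nonneg hj.le _)]
  ring

/-! ### Pointwise bounds for the waves -/

theorem exists_norm_le_of_continuous (hY : Continuous Y) : ∃ M, 0 ≤ M ∧ ∀ ξ, ‖Y ξ‖ ≤ M := by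
  obtain ⟨M, hM⟩ := (isCompact_univ (X := Metric.sphere (0 : EuclideanSpace ℝ (Fin d)) 1)
    ).exists_bound_of_continuousOn hY.continuousOn
  exact ⟨max M 0, le_max_right _ _, fun ξ => (hM ξ trivial).trans (le_max_left _ _)⟩

theorem norm_sphericalWave_le {M : ℝ} (hM : ∀ ξ, ‖Y ξ‖ ≤ M) (ν j : ℝ)
    {x : EuclideanSpace ℝ (Fin d)} (hx : x ≠ 0) :
    ‖sphericalWave ν j Y x‖ ≤ ‖x‖ ^ (1 - (d : ℝ) / 2) * |besselJ ν (j * ‖x‖)| * M := by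
  simp only [sphericalWave, dif_neg hx, norm_mul, RCLike.norm_ofReal, abs_mul]
  rw [abs_of_nonneg (Real.rpow_nonneg (norm_nonneg x) _)]
  gcongr
  exact hM _

/-- The factor `r^ν` of `J_ν` compensates the singular `r^(1 - d/2)`, since `1 - d/2 + ν ≥ 0`; the
entire factor is bounded on the compact range of its argument. -/
theorem exists_norm_sphericalWave_le {ν j : ℝ} (hν : 0 ≤ ν) (hνd : (d : ℝ) / 2 - 1 ≤ ν)
    (hj : 0 < j) (hY : Continuous Y) :
    ∃ C, ∀ x : EuclideanSpace ℝ (Fin d), ‖x‖ < 1 → ‖sphericalWave ν j Y x‖ ≤ C := by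
  obtain ⟨M, hM0, hM⟩ := exists_norm_le_of_continuous hY
  obtain ⟨G, hG⟩ := (isCompact_Icc (a := (0 : ℝ)) (b := j ^ 2 / 4)).exists_bound_of_continuousOn
    (continuous_besselEntire hν).continuousOn
  have hG0 : 0 ≤ G := (norm_nonneg _).trans (hG 0 ⟨le_rfl, by positivity⟩)
  refine ⟨(j / 2) ^ ν * G * M, fun x hx1 => ?_⟩
  by_cases hx : x = 0
  · simp only [sphericalWave, dif_pos hx, norm_zero]
    positivity
  have hn : 0 < ‖x‖ := norm_pos_iff.2 hx
  refine (norm_sphericalWave_le hM ν j hx).trans ?_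
  refine mul_le_mul_of_nonneg_right ?_ hM0
  rw [besselJ_eq (mul_pos hj hn), abs_mul, abs_of_nonneg (by positivity),
    show j * ‖x‖ / 2 = j / 2 * ‖x‖ by ring, Real.mul_rpow (by positivity) hn.le]
  have h1 : ‖x‖ ^ (1 - (d : ℝ) / 2) * ‖x‖ ^ ν ≤ 1 := by
    rw [← Real.rpow_add hn]
    exact Real.rpow_le_one hn.le hx1.le (by linarith)
  have h2 : |besselEntire ν ((j * ‖x‖) ^ 2 / 4)| ≤ G := by
    refine hG _ ⟨by positivity, ?_⟩
    have : j * ‖x‖ ≤ j := by nlinarith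
    gcongr
  calc ‖x‖ ^ (1 - (d : ℝ) / 2) *
        ((j / 2) ^ ν * ‖x‖ ^ ν * |besselEntire ν ((j * ‖x‖) ^ 2 / 4)|)
      = (j / 2) ^ ν * (‖x‖ ^ (1 - (d : ℝ) / 2) * ‖x‖ ^ ν) *
        |besselEntire ν ((j * ‖x‖) ^ 2 / 4)| := by ring
    _ ≤ (j / 2) ^ ν * 1 * G := by gcongr
    _ = (j / 2) ^ ν * G := by ring

/-- The point is that `A` does not depend on `j`: the condition `1 ≤ j ε` puts the whole shell in
the range where `J_ν` decays like `t^(-1/2)`. -/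
theorem exists_norm_sphericalWave_le_rpow (hd : 2 ≤ d) {ν ε : ℝ} (hν : 0 ≤ ν) (hε : 0 < ε)
    (hY : Continuous Y) :
    ∃ A, 0 ≤ A ∧ ∀ j, 1 ≤ j * ε → ∀ x : EuclideanSpace ℝ (Fin d), ε ≤ ‖x‖ →
      ‖sphericalWave ν j Y x‖ ≤ A * j ^ (-(1 / 2) : ℝ) := by
  obtain ⟨M, hM0, hM⟩ := exists_norm_le_of_continuous hY
  obtain ⟨C, hC0, hC⟩ := exists_abs_besselJ_le hν
  refine ⟨ε ^ (1 - (d : ℝ) / 2) * (C * ε ^ (-(1 / 2) : ℝ)) * M, by positivity,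
    fun j hj x hx => ?_⟩
  have hj0 : 0 < j := by
    by_contra! h
    nlinarith
  have hn : 0 < ‖x‖ := hε.trans_le hx
  have hjx : j * ε ≤ j * ‖x‖ := by gcongr
  have hd' : (2 : ℝ) ≤ d := by exact_mod_cast hd
  refine (norm_sphericalWave_le hM ν j (norm_pos_iff.1 hn)).trans ?_
  have h1 : ‖x‖ ^ (1 - (d : ℝ) / 2) ≤ ε ^ (1 - (d : ℝ) / 2) :=
    Real.rpow_le_rpow_of_nonpos hε hx (by linarith)
  have h2 : |besselJ ν (j * ‖x‖)| ≤ C * (j * ε) ^ (-(1 / 2) : ℝ) := by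
    refine (hC _ (hj.trans hjx)).trans (mul_le_mul_of_nonneg_left ?_ hC0)
    exact Real.rpow_le_rpow_of_nonpos (by positivity) hjx (by norm_num)
  rw [Real.mul_rpow hj0.le hε.le] at h2
  calc ‖x‖ ^ (1 - (d : ℝ) / 2) * |besselJ ν (j * ‖x‖)| * M
      ≤ ε ^ (1 - (d : ℝ) / 2) * (C * (j ^ (-(1 / 2) : ℝ) * ε ^ (-(1 / 2) : ℝ))) * M := by gcongr
    _ = _ := by ring

theorem exists_ball_le_norm_sphericalWave {ν j : ℝ} (hν : 0 ≤ ν) (hj : 0 < j) (hY : Continuous Y)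
    (hY0 : Y ≠ 0) :
    ∃ (y : EuclideanSpace ℝ (Fin d)) (r m : ℝ), 0 < r ∧ 0 < m ∧
      Metric.ball y r ⊆ Metric.ball 0 1 ∧
      ∀ x ∈ Metric.ball y r, m ≤ ‖sphericalWave ν j Y x‖ := by
  obtain ⟨ξ, hξ⟩ := Function.ne_iff.1 hY0
  -- Since `J_ν` has no zeros just to the right of `0`, a radius below `1` with `J_ν(j t) ≠ 0`
  -- exists for any `j`.
  obtain ⟨s, hs, hs1⟩ := ((eventually_besselJ_ne_zero_nhdsGT hν).and
    (Ioo_mem_nhdsGT hj)).exists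
  obtain ⟨t, ht0, ht1, rfl⟩ : ∃ t, 0 < t ∧ t < 1 ∧ j * t = s :=
    ⟨s / j, div_pos hs1.1 hj, (div_lt_one hj).2 hs1.2, mul_div_cancel₀ _ hj.ne'⟩
  have hξ1 : ‖(ξ : EuclideanSpace ℝ (Fin d))‖ = 1 := by simp
  set y := t • (ξ : EuclideanSpace ℝ (Fin d))
  have hyn : ‖y‖ = t := by rw [norm_smul, hξ1, Real.norm_of_nonneg ht0.le, mul_one]
  have hy0 : y ≠ 0 := norm_pos_iff.1 (hyn ▸ ht0)
  have hpt : ‖y‖⁻¹ • y = ξ := by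
    rw [hyn, smul_smul, inv_mul_cancel₀ ht0.ne', one_smul]
  have hne : sphericalWave ν j Y y ≠ 0 := by
    have hs' : besselJ ν (j * ‖y‖) ≠ 0 := by rwa [hyn]
    simp only [sphericalWave, dif_neg hy0, hpt]
    refine mul_ne_zero (RCLike.ofReal_ne_zero.2 (mul_ne_zero ?_ hs')) hξ
    exact (Real.rpow_pos_of_pos (norm_pos_iff.2 hy0) _).ne'
  have hpos := norm_pos_iff.2 hne
  have hcont : ContinuousAt (sphericalWave ν j Y) y :=
    (continuousOn_sphericalWave hν hj hY).continuousAt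
      (isOpen_compl_singleton.mem_nhds hy0)
  have hev := (hcont.norm.eventually_const_lt (half_lt_self hpos)).and
    (Metric.isOpen_ball.mem_nhds (by simpa [hyn] using ht1 :
      y ∈ Metric.ball (0 : EuclideanSpace ℝ (Fin d)) 1))
  obtain ⟨r, hr, hball⟩ := Metric.eventually_nhds_iff_ball.1 hev
  exact ⟨y, r, _, hr, half_pos hpos, fun x hx => (hball x hx).2, fun x hx => (hball x hx).1.le⟩

end Wave

/-! ### Bounds in `L^p` and their quotient -/

/-- The case `p = ∞` is included: there `p.toReal⁻¹ = 0`, so the volume factor is `1`. -/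
theorem le_eLpNorm_of_le_on_ball {F : Type*} [NormedAddCommGroup F] {d : ℕ} (hd : 0 < d)
    {f : EuclideanSpace ℝ (Fin d) → F} {y : EuclideanSpace ℝ (Fin d)} {r m : ℝ} (hr : 0 < r)
    (hm : 0 ≤ m) (hsub : Metric.ball y r ⊆ Metric.ball 0 1)
    (hf : ∀ x ∈ Metric.ball y r, m ≤ ‖f x‖) {p : ENNReal} (hp : p ≠ 0) :
    ENNReal.ofReal (m * (r ^ d *
        volume.real (Metric.ball (0 : EuclideanSpace ℝ (Fin d)) 1)) ^ p.toReal⁻¹) ≤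
      eLpNorm f p (volume.restrict {x : EuclideanSpace ℝ (Fin d) | ‖x‖ < 1}) := by
  have : Nonempty (Fin d) := ⟨⟨0, hd⟩⟩
  have hset : {x : EuclideanSpace ℝ (Fin d) | ‖x‖ < 1} = Metric.ball 0 1 := by
    ext x
    simp
  have hvol : volume (Metric.ball y r) = ENNReal.ofReal (r ^ d *
      volume.real (Metric.ball (0 : EuclideanSpace ℝ (Fin d)) 1)) := by
    rw [Measure.addHaar_ball _ _ hr.le, finrank_euclideanSpace_fin,
      ENNReal.ofReal_mul (by positivity), ofReal_measureReal measure_ball_lt_top.ne]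
  have hne : volume.restrict (Metric.ball y r) ≠ 0 := by
    rw [Ne, Measure.restrict_eq_zero]
    exact (Metric.measure_ball_pos volume y hr).ne'
  calc ENNReal.ofReal (m * (r ^ d *
        volume.real (Metric.ball (0 : EuclideanSpace ℝ (Fin d)) 1)) ^ p.toReal⁻¹)
      = eLpNorm (fun _ : EuclideanSpace ℝ (Fin d) => m) p
          (volume.restrict (Metric.ball y r)) := by
        rw [eLpNorm_const _ hp hne, Measure.restrict_apply_univ, hvol, one_div,
          ENNReal.ofReal_mul hm, Real.enorm_eq_ofReal hm,
          ENNReal.ofReal_rpow_of_nonneg (by positivity) (by positivity)]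
    _ ≤ eLpNorm f p (volume.restrict (Metric.ball y r)) := by
        refine eLpNorm_mono_ae ((ae_restrict_iff' measurableSet_ball).2 (ae_of_all _ ?_))
        intro x hx
        rw [Real.norm_of_nonneg hm]
        exact hf x hx
    _ ≤ _ := by
        rw [hset]
        exact eLpNorm_mono_measure _ (Measure.restrict_mono hsub le_rfl)

section Wave

variable {𝕜 : Type*} [RCLike 𝕜] {d : ℕ} {Y : Metric.sphere (0 : EuclideanSpace ℝ (Fin d)) 1 → 𝕜}

theorem eLpNorm_sphericalWave_ne_zero (hd : 0 < d) {ν j : ℝ} (hν : 0 ≤ ν) (hj : 0 < j)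
    (hY : Continuous Y) (hY0 : Y ≠ 0) {p : ENNReal} (hp : p ≠ 0) :
    eLpNorm (sphericalWave ν j Y) p
      (volume.restrict {x : EuclideanSpace ℝ (Fin d) | ‖x‖ < 1}) ≠ 0 := by
  obtain ⟨y, r, m, hr, hm, hsub, h⟩ := exists_ball_le_norm_sphericalWave hν hj hY hY0
  refine ((ENNReal.ofReal_pos.2 ?_).trans_le
    (le_eLpNorm_of_le_on_ball hd hr hm.le hsub h hp)).ne'
  have : 0 < volume.real (Metric.ball (0 : EuclideanSpace ℝ (Fin d)) 1) :=
    ENNReal.toReal_pos (Metric.measure_ball_pos volume _ one_pos).ne' measure_ball_lt_top.ne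
  positivity

/-- The `L^p` norm over the unit ball is bounded below by concentration at scale `1 / j`. -/
theorem exists_le_eLpNorm_sphericalWave (hd : 0 < d) {ν : ℝ} (hν : 0 ≤ ν) (hY : Continuous Y)
    (hY0 : Y ≠ 0) {p : ENNReal} (hp : p ≠ 0) :
    ∃ B, 0 < B ∧ ∀ j, 1 ≤ j →
      ENNReal.ofReal (B * j ^ ((d : ℝ) / 2 - 1 - d * p.toReal⁻¹)) ≤
        eLpNorm (sphericalWave ν j Y) p
          (volume.restrict {x : EuclideanSpace ℝ (Fin d) | ‖x‖ < 1}) := by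
  obtain ⟨y, r, m, hr, hm, hsub, h⟩ := exists_ball_le_norm_sphericalWave hν one_pos hY hY0
  have hv : 0 < volume.real (Metric.ball (0 : EuclideanSpace ℝ (Fin d)) 1) :=
    ENNReal.toReal_pos (Metric.measure_ball_pos volume _ one_pos).ne' measure_ball_lt_top.ne
  refine ⟨m * (r ^ d * volume.real (Metric.ball (0 : EuclideanSpace ℝ (Fin d)) 1)) ^ p.toReal⁻¹,
    by positivity, fun j hj => ?_⟩
  have hj0 : 0 < j := by linarith
  have hscale : ∀ x ∈ Metric.ball (j⁻¹ • y) (j⁻¹ * r), j • x ∈ Metric.ball y r := by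
    intro x hx
    rw [mem_ball_iff_norm] at hx ⊢
    have : j • x - y = j • (x - j⁻¹ • y) := by
      rw [smul_sub, smul_smul, mul_inv_cancel₀ hj0.ne', one_smul]
    rw [this, norm_smul, Real.norm_of_nonneg hj0.le]
    calc j * ‖x - j⁻¹ • y‖ < j * (j⁻¹ * r) := by gcongr
      _ = r := by field_simp
  -- The dilation contributes `j^(d/2 - 1)` in amplitude and `j^(-d)` in volume, the latter to the
  -- power `1/p`.
  refine le_trans (le_of_eq ?_) (le_eLpNorm_of_le_on_ball hd (y := j⁻¹ • y) (r := j⁻¹ * r)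
    (m := j ^ ((d : ℝ) / 2 - 1) * m) (by positivity) (by positivity) ?_ ?_ hp)
  · congr 1
    rw [mul_pow, mul_assoc (j⁻¹ ^ d), Real.mul_rpow (x := j⁻¹ ^ d) (by positivity) (by positivity),
      inv_pow, Real.inv_rpow (by positivity), ← Real.rpow_natCast_mul hj0.le,
      ← Real.rpow_neg hj0.le, sub_eq_add_neg ((d : ℝ) / 2 - 1), Real.rpow_add hj0]
    ring
  · intro x hx
    have h1 := hsub (hscale x hx)
    rw [mem_ball_zero_iff, norm_smul, Real.norm_of_nonneg hj0.le] at h1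
    rw [mem_ball_zero_iff]
    nlinarith [norm_nonneg x]
  · intro x hx
    rw [norm_sphericalWave_eq ν hj0 x]
    gcongr
    exact h _ (hscale x hx)

theorem memLp_sphericalWave (hd : 2 ≤ d) {ν j : ℝ} (hν : 0 ≤ ν) (hνd : (d : ℝ) / 2 - 1 ≤ ν)
    (hj : 0 < j) (hY : Continuous Y) (p : ENNReal) :
    MemLp (sphericalWave ν j Y) p
      (volume.restrict {x : EuclideanSpace ℝ (Fin d) | ‖x‖ < 1}) := by
  have hset : {x : EuclideanSpace ℝ (Fin d) | ‖x‖ < 1} = Metric.ball 0 1 := by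
    ext x
    simp
  obtain ⟨C, hC⟩ := exists_norm_sphericalWave_le hν hνd hj hY
  rw [hset]
  have : IsFiniteMeasure
      (volume.restrict (Metric.ball (0 : EuclideanSpace ℝ (Fin d)) 1)) :=
    ⟨by simpa using measure_ball_lt_top⟩
  refine MemLp.of_bound (aestronglyMeasurable_sphericalWave hd hν hj hY).restrict C
    ((ae_restrict_iff' measurableSet_ball).2 (ae_of_all _ fun x hx => hC x ?_))
  exact mem_ball_zero_iff.1 hx

theorem exists_eLpNorm_sphericalWave_le (hd : 2 ≤ d) {ν ε : ℝ} (hν : 0 ≤ ν) (hε : 0 < ε)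
    (hY : Continuous Y) (p : ENNReal) :
    ∃ A, 0 ≤ A ∧ ∀ j, 1 ≤ j * ε →
      eLpNorm (sphericalWave ν j Y) p
        (volume.restrict {x : EuclideanSpace ℝ (Fin d) | ε ≤ ‖x‖ ∧ ‖x‖ ≤ 1}) ≤
      ENNReal.ofReal (A * j ^ (-(1 / 2) : ℝ)) := by
  obtain ⟨A, hA0, hA⟩ := exists_norm_sphericalWave_le_rpow (Y := Y) hd hν hε hY
  set S := {x : EuclideanSpace ℝ (Fin d) | ε ≤ ‖x‖ ∧ ‖x‖ ≤ 1}
  have hS : MeasurableSet S :=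
    (measurableSet_le measurable_const measurable_norm).inter
      (measurableSet_le measurable_norm measurable_const)
  have hSfin : volume S ≠ ⊤ := by
    refine ((measure_mono (t := Metric.closedBall 0 1) fun x hx => ?_).trans_lt
      measure_closedBall_lt_top).ne
    exact mem_closedBall_zero_iff.2 hx.2
  refine ⟨volume.real S ^ p.toReal⁻¹ * A, by positivity, fun j hj => ?_⟩
  refine (eLpNorm_le_of_ae_bound (C := A * j ^ (-(1 / 2) : ℝ))
    ((ae_restrict_iff' hS).2 (ae_of_all _ fun x hx => hA j hj x hx.1))).trans (le_of_eq ?_)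
  rw [Measure.restrict_apply_univ, mul_assoc,
    ENNReal.ofReal_mul (p := volume.real S ^ p.toReal⁻¹) (by positivity),
    ← ofReal_measureReal hSfin, ENNReal.ofReal_rpow_of_nonneg (by positivity) (by positivity)]

/-- The critical exponent `2d/(d-1)` enters here only. For `p = ∞` the left side is `0`. -/
theorem mul_inv_toReal_lt {d : ℕ} (hd : 2 ≤ d) {p : ENNReal}
    (hp : ENNReal.ofReal (2 * (d : ℝ) / ((d : ℝ) - 1)) < p) :
    (d : ℝ) * p.toReal⁻¹ < ((d : ℝ) - 1) / 2 := by
  have hd' : (2 : ℝ) ≤ d := by exact_mod_cast hd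
  by_cases htop : p = ⊤
  · simp [htop]
    linarith
  have h := (ENNReal.ofReal_lt_iff_lt_toReal (div_nonneg (by linarith) (by linarith)) htop).1 hp
  have hpos : 0 < p.toReal := (div_pos (by linarith) (by linarith)).trans h
  rw [div_lt_iff₀ (by linarith)] at h
  rw [← div_eq_mul_inv, div_lt_iff₀ hpos]
  linarith

/-- The limit holds along all real frequencies `j → ∞`; that `j` is a zero of `J_ν` plays no role.
-/
theorem tendsto_eLpNorm_sphericalWave_ratio (hd : 2 ≤ d) {ν ε : ℝ} (hν : 0 ≤ ν) (hε : 0 < ε)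
    (hY : Continuous Y) (hY0 : Y ≠ 0) {p : ENNReal}
    (hp : ENNReal.ofReal (2 * (d : ℝ) / ((d : ℝ) - 1)) < p) :
    Tendsto
      (fun j : ℝ =>
        eLpNorm (sphericalWave ν j Y) p
          (volume.restrict {x : EuclideanSpace ℝ (Fin d) | ε ≤ ‖x‖ ∧ ‖x‖ ≤ 1}) /
        eLpNorm (sphericalWave ν j Y) p
          (volume.restrict {x : EuclideanSpace ℝ (Fin d) | ‖x‖ < 1}))
      atTop (𝓝 0) := by
  obtain ⟨A, hA0, hA⟩ := exists_eLpNorm_sphericalWave_le (Y := Y) hd hν hε hY p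
  obtain ⟨B, hB0, hB⟩ := exists_le_eLpNorm_sphericalWave (by omega) hν hY hY0
    (pos_of_gt hp).ne'
  have hexp : 0 < ((d : ℝ) - 1) / 2 - d * p.toReal⁻¹ := sub_pos.2 (mul_inv_toReal_lt hd hp)
  have hlim : Tendsto
      (fun j : ℝ => ENNReal.ofReal (A / B * j ^ (-(((d : ℝ) - 1) / 2 - d * p.toReal⁻¹))))
      atTop (𝓝 0) := by
    have := ENNReal.tendsto_ofReal ((tendsto_rpow_neg_atTop hexp).const_mul (A / B))
    simpa using this
  refine tendsto_of_tendsto_of_tendsto_of_le_of_le' tendsto_const_nhds hlim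
    (Eventually.of_forall fun _ => zero_le) ?_
  filter_upwards [eventually_ge_atTop 1, eventually_ge_atTop ε⁻¹] with j hj1 hjε
  have hj0 : 0 < j := by linarith
  have hjε' : 1 ≤ j * ε := by
    rwa [inv_le_iff_one_le_mul₀ hε] at hjε
  -- The exponents combine as `-1/2 - (d/2 - 1 - d/p) = -((d-1)/2 - d/p)`.
  refine (ENNReal.div_le_div (hA j hjε') (hB j hj1)).trans (le_of_eq ?_)
  rw [← ENNReal.ofReal_div_of_pos (by positivity), mul_div_mul_comm, ← Real.rpow_sub hj0]
  congr 3
  ring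

end Wave

theorem corollary2p7 {𝕜 : Type*} [RCLike 𝕜] (d : ℕ) (hd : 2 ≤ d) (c : ℝ) (hc : 0 ≤ c) (l : ℕ)
    (Y : Metric.sphere (0 : EuclideanSpace ℝ (Fin d)) 1 → 𝕜)
    (hY : Y ∈ sphericalHarmonics 𝕜 d l) (hY0 : Y ≠ 0)
    (p : ENNReal) (hp : ENNReal.ofReal (2 * (d : ℝ) / ((d : ℝ) - 1)) < p)
    (ε : ℝ) (hε : 0 < ε) :
    (∀ k : ℕ, 1 ≤ k →
      MemLp (ballEigenfunction c d l k Y) p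
        (volume.restrict {x : EuclideanSpace ℝ (Fin d) | ‖x‖ < 1}) ∧
      eLpNorm (ballEigenfunction c d l k Y) p
        (volume.restrict {x : EuclideanSpace ℝ (Fin d) | ‖x‖ < 1}) ≠ 0) ∧
    Tendsto
      (fun k : ℕ =>
        eLpNorm (ballEigenfunction c d l k Y) p
          (volume.restrict {x : EuclideanSpace ℝ (Fin d) | ε ≤ ‖x‖ ∧ ‖x‖ ≤ 1}) /
        eLpNorm (ballEigenfunction c d l k Y) p
          (volume.restrict {x : EuclideanSpace ℝ (Fin d) | ‖x‖ < 1}))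
      atTop (𝓝 0) := by
  have hcont := continuous_of_mem_sphericalHarmonics hY
  have hν := besselOrder_nonneg c d l
  simp only [ballEigenfunction_eq]
  refine ⟨fun k hk => ⟨?_, ?_⟩, ?_⟩
  · exact memLp_sphericalWave hd hν (le_besselOrder c d l) (besselZero_pos hν hk) hcont p
  · exact eLpNorm_sphericalWave_ne_zero (by omega) hν (besselZero_pos hν hk) hcont hY0
      (pos_of_gt hp).ne'
  · exact (tendsto_eLpNorm_sphericalWave_ratio hd hν hε hcont hY0 hp).comp (tendsto_besselZero hν)
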